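/- Let $K$ be a field and let $G$ be a finite simple undirected graph with vertex set $\{1,\dots,n\}$. Let $I=I(G)=\langle x_ix_j : \{i,j\}\in E(G)\rangle\subseteq R=K[x_1,\dots,x_n]$ be its edge ideal. For an ideal $I$ of $R$ and $s\ge 1$, the symbolic power is $I^{(s)}=(M^{-1}I^s)\cap R$, i.e. the preimage in $R$ of the extension of $I^s$ to $M^{-1}R$, where $M$ is the set of elements of $R$ lying in no minimal prime of $I$. The join of two ideals $I,J$ of $R$ is $$I\ast J=\bigl(I(\mathbf y)+J(\mathbf z)+\langle x_i-y_i-z_i : 1\le i\le n\rangle\bigr)\cap K[\mathbf x],$$ computed in $K[\mathbf x,\mathbf y,\mathbf z]$, where $I(\mathbf y)$ denotes $I$ with each $x_i$ replaced by $y_i$; the secant ideal $I^{\{s\}}=I\ast\cdots\ast I$ is the $s$-fold join, with $I^{\{1\}}=I$. The ideal $I$ is $1$-differentially perfect if for all $s\ge 1$ $$I^{(s)}=I^{\{s\}}+\sum_{i=1}^{s-1}I^{(i)}I^{(s-i)} .$$ The graph $G$ is perfect if for every $W\subseteq\{1,\dots,n\}$ the clique number and the chromatic number of the induced subgraph $G_W$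 coincide. Then the edge ideal $I(G)$ is $1$-differentially perfect if and only if $G$ is a perfect graph. -/

import Mathlib

noncomputable section

namespace SymbolicPowers

/-- The elements of `R` lying in no minimal prime of `I`, as a multiplicative set. -/
def avoidMinimalPrimes {R : Type*} [CommRing R] (I : Ideal R) : Submonoid R where
  carrier := {a | ∀ p ∈ I.minimalPrimes, a ∉ p}
  one_mem' := fun _ hp => (Ideal.ne_top_iff_one _).1 hp.1.1.ne_top
  mul_mem' := fun ha hb p hp hab => (hp.1.1.mem_or_mem hab).elim (ha p hp) (hb p hp)

/-- The symbolic power `I^(r)`: extend `I ^ r` to the localization of `R` at the complement of the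
union of the minimal primes of `I`, and contract back to `R`. -/
def symbolicPower {R : Type*} [CommRing R] (I : Ideal R) (r : ℕ) : Ideal R :=
  ((I ^ r).map (algebraMap R (Localization (avoidMinimalPrimes I)))).comap
    (algebraMap R (Localization (avoidMinimalPrimes I)))

variable {σ K : Type*} [Field K]

/-- The join of `I` and `J`: `(I(y) + J(z) + ⟨x_i - y_i - z_i⟩) ∩ K[x]`, computed in
`K[x, y, z]`, whose variables `x_i`, `y_i`, `z_i` are `Sum.inl i`, `Sum.inr (Sum.inl i)` and
`Sum.inr (Sum.inr i)`. -/
def join (I J : Ideal (MvPolynomial σ K)) : Ideal (MvPolynomial σ K) :=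
  (I.map (MvPolynomial.rename (R := K) (fun i : σ => (Sum.inr (Sum.inl i) : σ ⊕ σ ⊕ σ)))
    + J.map (MvPolynomial.rename (R := K) (fun i : σ => (Sum.inr (Sum.inr i) : σ ⊕ σ ⊕ σ)))
    + Ideal.span (Set.range fun i : σ =>
        (MvPolynomial.X (Sum.inl i) - MvPolynomial.X (Sum.inr (Sum.inl i))
          - MvPolynomial.X (Sum.inr (Sum.inr i)) : MvPolynomial (σ ⊕ σ ⊕ σ) K))).comap
    (MvPolynomial.rename (R := K) (fun i : σ => (Sum.inl i : σ ⊕ σ ⊕ σ)))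

/-- The secant ideal `I^{r}`, the `r`-fold join of `I` with itself. It is meant for `1 ≤ r`; at `0`
it is the ideal generated by the variables, the neutral element for joins. -/
def secantIdeal (I : Ideal (MvPolynomial σ K)) : ℕ → Ideal (MvPolynomial σ K)
  | 0 => Ideal.span (Set.range MvPolynomial.X)
  | 1 => I
  | r + 2 => join (secantIdeal I (r + 1)) I

/-- `I` is `r`-differentially perfect (for `1 ≤ r`). -/
def IsDifferentiallyPerfect (r : ℕ) (I : Ideal (MvPolynomial σ K)) : Prop :=
  ∀ s : ℕ, 1 ≤ s →
    symbolicPower (secantIdeal I r) s =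
      secantIdeal I (r + s - 1) +
        ∑ i ∈ Finset.Ico 1 s,
          symbolicPower (secantIdeal I r) i * symbolicPower (secantIdeal I r) (s - i)

/-- The edge ideal of a graph: generated by `x_i x_j` for the edges `{i, j}`. -/
def edgeIdeal (K : Type*) [Field K] {V : Type*} (G : SimpleGraph V) : Ideal (MvPolynomial V K) :=
  Ideal.span {p | ∃ i j, G.Adj i j ∧ p = MvPolynomial.X i * MvPolynomial.X j}

/-- A graph is perfect if the clique number and the chromatic number of every induced subgraph
agree. -/
def IsPerfect {V : Type*} (G : SimpleGraph V) : Prop :=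
  ∀ W : Set V, ((G.induce W).cliqueNum : ℕ∞) = (G.induce W).chromaticNumber

end SymbolicPowers

end

/-! All ideals in the defining equation are monomial, so it becomes a statement about exponents. The
secant ideal `I^{s}` is spanned by the monomials whose support is not `s`-colourable
(`secantIdeal_edgeIdeal`). The symbolic power `I^(s)` is spanned by the monomials of weight at least
`s` on every vertex cover (`mem_symbolicPower_edgeIdeal`, with `CoverWeight`). Hence `I` is
`1`-differentially perfect iff every cover weight of level `s ≥ 1` has a support that is not
`s`-colourable or splits into cover weights of levels `i` and `s - i` with `1 ≤ i < s`
(`isDifferentiallyPerfect_edgeIdeal_iff`).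

The combinatorial tool is Lovász's weak perfect graph theorem in weighted form
(`PerfectOn.exists_clique_cover`). If `G` is perfect and `a` has level `s`, stable sets weigh at
most `m = |a| - s`, so `m` cliques cover each `v` exactly `a v` times. As `|a| > m`, one of them,
`Q`, has at least two vertices. Either `Q` has more than `s` vertices and obstructs an
`s`-colouring, or the indicator of `Q`, of level `#Q - 1`, splits off.

Conversely, let all proper subsets of `U` be perfect and let `S` be a largest stable set in `U`. The
indicator of `U` has level `#(U \ S)`. If `U` is not `#(U \ S)`-colourable, its clique and chromatic
numbers agree by a direct argument. Otherwise the indicator splits, `U` is partitioned into two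
smaller perfect pieces, and their clique covers together use at most `#S` cliques. Thus the
complement is perfect on `U`, and so is `G`. -/

namespace SymbolicPowers

open Finset

/-! ### Weighted colourings, clique covers and the weak perfect graph theorem. -/

section Graph

variable {V : Type*}

/-- The set `W` of vertices can be properly coloured with the colours `0, …, m - 1`. -/
def ColorableOn (G : SimpleGraph V) (W : Set V) (m : ℕ) : Prop :=
  ∃ c : V → ℕ, (∀ v ∈ W, c v < m) ∧ ∀ u ∈ W, ∀ v ∈ W, G.Adj u v → c u ≠ c v

/-- Every subset `W` of `U` can be coloured with as many colours as the largest clique in `W` has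
vertices. -/
def PerfectOn (G : SimpleGraph V) (U : Finset V) : Prop :=
  ∀ W ⊆ U, ∀ m : ℕ, (∀ Q ⊆ W, G.IsClique (Q : Set V) → #Q ≤ m) → ColorableOn G (W : Set V) m

theorem PerfectOn.mono {G : SimpleGraph V} {U W : Finset V} (h : PerfectOn G U) (hW : W ⊆ U) :
    PerfectOn G W :=
  fun X hX => h X (hX.trans hW)

/-- A clique inside an `m`-colourable set has at most `m` vertices. -/
theorem ColorableOn.card_le {G : SimpleGraph V} {W : Set V} {m : ℕ} (h : ColorableOn G W m)
    {Q : Finset V} (hQ : G.IsClique (Q : Set V)) (hQW : (Q : Set V) ⊆ W) : #Q ≤ m := by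
  obtain ⟨c, hc, hadj⟩ := h
  have := Finset.card_le_card_of_injOn (s := Q) (t := Finset.range m) c
    (fun v hv => by simpa using hc v (hQW hv))
    (fun u hu v hv huv => by
      by_contra hne
      exact hadj u (hQW hu) v (hQW hv) (hQ hu hv hne) huv)
  simpa using this

theorem card_inter_le_one [DecidableEq V] {G : SimpleGraph V} {Q S : Finset V}
    (hQ : G.IsClique (Q : Set V)) (hS : G.IsIndepSet (S : Set V)) : #(Q ∩ S) ≤ 1 := by
  rw [Finset.card_le_one]
  intro u hu v hv
  simp only [Finset.mem_inter] at hu hv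
  by_contra hne
  exact hS hu.2 hv.2 hne (hQ hu.1 hv.1 hne)

theorem sum_map_le_card_mul (L : Multiset (Finset V)) (f : Finset V → ℕ) (n : ℕ)
    (h : ∀ S ∈ L, f S ≤ n) : (L.map f).sum ≤ Multiset.card L * n := by
  have := Multiset.sum_le_card_nsmul (L.map f) n (by simpa using h)
  simpa using this

/-- A set covered by `m` cliques is `m`-colourable in the complementary graph. -/
theorem colorableOn_compl_of_clique_cover [DecidableEq V] {G : SimpleGraph V} {W : Set V}
    (L : Multiset (Finset V)) (hL : ∀ Q ∈ L, G.IsClique (Q : Set V))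
    (hW : ∀ v ∈ W, ∃ Q ∈ L, v ∈ Q) : ColorableOn Gᶜ W (Multiset.card L) := by
  induction L using Quotient.inductionOn with
  | _ l =>
  change ∀ Q ∈ l, _ at hL
  change ∀ v ∈ W, ∃ Q ∈ l, v ∈ Q at hW
  have hex : ∀ v ∈ W, l.findIdx (fun Q => decide (v ∈ Q)) < l.length := by
    intro v hv
    rw [List.findIdx_lt_length]
    simpa using hW v hv
  have hget : ∀ v (hv : v ∈ W), v ∈ l[l.findIdx (fun Q => decide (v ∈ Q))]'(hex v hv) := by
    intro v hv
    simpa using List.findIdx_getElem (xs := l) (p := fun Q => decide (v ∈ Q)) (w := hex v hv)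
  refine ⟨fun v => l.findIdx fun Q => decide (v ∈ Q), hex, fun u hu v hv huv heq => ?_⟩
  have hu' := hget u hu
  simp only [heq] at hu'
  rw [SimpleGraph.compl_adj] at huv
  exact huv.2 (hL _ (List.getElem_mem _) hu' (hget v hv) huv.1)

variable [Fintype V] [DecidableEq V]

/-- Double counting for a multiset of sets that covers each vertex `v` exactly `w v` times. -/
theorem sum_countP_mul (L : Multiset (Finset V)) (a : V → ℕ) :
    ∑ v, L.countP (v ∈ ·) * a v = (L.map fun S => ∑ v ∈ S, a v).sum := by
  induction L using Multiset.induction_on with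
  | empty => simp
  | cons S L ih =>
    simp only [Multiset.countP_cons, add_mul, Finset.sum_add_distrib, ih, Multiset.map_cons,
      Multiset.sum_cons]
    rw [add_comm]
    congr 1
    simp

theorem sum_countP_eq_sum_card_inter (L : Multiset (Finset V)) (Q : Finset V) :
    ∑ v ∈ Q, L.countP (v ∈ ·) = (L.map fun S => #(S ∩ Q)).sum := by
  have h := sum_countP_mul L (fun v => if v ∈ Q then 1 else 0)
  simpa [Finset.sum_ite_mem] using h

/-- Weighted colourings of perfect graphs: if every clique has weight at most `m`, then `m` stable
sets cover each vertex exactly as often as its weight says. -/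
theorem PerfectOn.exists_indepSet_cover {G : SimpleGraph V} {U : Finset V} (hG : PerfectOn G U) :
    ∀ (n : ℕ) (w : V → ℕ) (m : ℕ), ∑ v, w v = n → (∀ v, w v ≠ 0 → v ∈ U) →
      (∀ Q : Finset V, G.IsClique (Q : Set V) → ∑ v ∈ Q, w v ≤ m) →
      ∃ L : Multiset (Finset V), Multiset.card L = m ∧ (∀ S ∈ L, G.IsIndepSet (S : Set V)) ∧
        ∀ v, L.countP (v ∈ ·) = w v := by
  intro n
  induction n using Nat.strong_induction_on with
  | _ n ih =>
  intro w m hn hU hm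
  by_cases hle : ∀ v, w v ≤ 1
  · obtain ⟨c, hc, hadj⟩ := hG (univ.filter fun v => w v ≠ 0)
      (fun v hv => hU v (by simpa using hv)) m
      (fun Q hQ hcl => by
        refine le_trans ?_ (hm Q hcl)
        rw [Finset.card_eq_sum_ones]
        refine Finset.sum_le_sum fun v hv => ?_
        have := hQ hv
        simp only [mem_filter, mem_univ, true_and] at this
        omega)
    simp only [coe_filter, mem_univ, true_and, Set.mem_ofPred_eq] at hc hadj
    refine ⟨(Multiset.range m).map fun j => univ.filter fun v => w v ≠ 0 ∧ c v = j, by simp, ?_, ?_⟩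
    · intro S hS
      obtain ⟨j, -, rfl⟩ := Multiset.mem_map.1 hS
      intro u hu v hv _ huv
      simp only [coe_filter, mem_univ, true_and, Set.mem_ofPred_eq] at hu hv
      exact hadj u hu.1 v hv.1 huv (hu.2.trans hv.2.symm)
    · intro v
      rw [Multiset.countP_map]
      simp only [mem_filter, mem_univ, true_and]
      by_cases hv : w v = 0
      · simp [hv]
      · have h1 : w v = 1 := by have := hle v; omega
        have : (Multiset.range m).filter (fun j => w v ≠ 0 ∧ c v = j) =
            ((Finset.range m).filter (fun j => c v = j)).val := by
          simp [hv, Finset.range]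
        rw [this, h1, ← Finset.card_def, Finset.filter_eq]
        simp [hc v hv]
  -- Lovász replication: lower the weight of a vertex `v` of weight at least two by one, take a
  -- stable set `S` through `v` from the resulting cover, and remove `S` from the original weight
  -- `w`.
  · push Not at hle
    obtain ⟨v, hv⟩ := hle
    obtain ⟨w', hw'⟩ : ∃ w' : V → ℕ, ∀ u, w' u = if u = v then w v - 1 else w u :=
      ⟨_, fun _ => rfl⟩
    have hlew : ∀ u, w' u ≤ w u := by
      intro u
      rw [hw']
      split_ifs with h
      · subst h; omega
      · exact le_rfl
    have hlt : ∑ u, w' u < n := by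
      rw [← hn]
      refine Finset.sum_lt_sum (fun u _ => hlew u) ⟨v, mem_univ _, ?_⟩
      rw [hw', if_pos rfl]; omega
    obtain ⟨L, hLc, hLi, hL⟩ := ih _ hlt w' m rfl
      (fun u hu => hU u (fun h => hu (by have := hlew u; omega)))
      (fun Q hQ => (Finset.sum_le_sum fun u _ => hlew u).trans (hm Q hQ))
    have hvL : 0 < L.countP (v ∈ ·) := by
      rw [hL, hw', if_pos rfl]; omega
    obtain ⟨S, hSL, hvS⟩ := Multiset.countP_pos.1 hvL
    obtain ⟨L', rfl⟩ := Multiset.exists_cons_of_mem hSL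
    have hSw : ∀ u ∈ S, 0 < w u := by
      intro u hu
      have h1 := hL u
      have h2 := hlew u
      rw [Multiset.countP_cons, if_pos hu] at h1
      omega
    -- The truncated subtraction is exact because `S` lies in the support of `w`.
    have hSsum : ∀ Q : Finset V,
        ∑ u ∈ Q, (w u - if u ∈ S then 1 else 0) + #(S ∩ Q) = ∑ u ∈ Q, w u := by
      intro Q
      have : #(S ∩ Q) = ∑ u ∈ Q, if u ∈ S then 1 else 0 := by
        simp [Finset.inter_comm]
      rw [this, ← Finset.sum_add_distrib]
      refine Finset.sum_congr rfl fun u _ => ?_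
      by_cases hu : u ∈ S
      · have := hSw u hu
        simp only [hu, if_true]; omega
      · simp [hu]
    have hm1 : 1 ≤ m := by rw [← hLc]; simp
    obtain ⟨L₂, hL₂c, hL₂i, hL₂⟩ := ih (∑ u, (w u - if u ∈ S then 1 else 0))
      (by
        have := hSsum univ
        have : 0 < #(S ∩ univ) := Finset.card_pos.2 ⟨v, by simpa using hvS⟩
        omega)
      (fun u => w u - if u ∈ S then 1 else 0) (m - 1) rfl
      (fun u hu => hU u (fun h => hu (by simp [h])))
      (fun Q hQ => by
        have hQm := hm Q hQ
        have hQS := hSsum Q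
        -- A clique meeting `S` loses weight. A clique missing `S` misses `v`, so its weight is
        -- already counted by the `m - 1` stable sets in `L'`, each of which meets it at most once.
        by_cases hmeet : #(S ∩ Q) = 0
        · have hdis : ∀ u ∈ Q, u ∉ S := by
            intro u hu huS
            rw [Finset.card_eq_zero] at hmeet
            exact absurd (Finset.mem_inter.2 ⟨huS, hu⟩) (by simp [hmeet])
          have hQw : ∑ u ∈ Q, w' u = ∑ u ∈ Q, w u := by
            refine Finset.sum_congr rfl fun u hu => ?_
            rw [hw', if_neg]
            rintro rfl
            exact hdis _ hu hvS
          have hcount := sum_countP_eq_sum_card_inter (S ::ₘ L') Q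
          rw [Finset.sum_congr rfl (fun u _ => hL u), hQw, Multiset.map_cons, Multiset.sum_cons,
            hmeet] at hcount
          have := sum_map_le_card_mul L' (fun T => #(T ∩ Q)) 1 (fun T hT => by
            rw [Finset.inter_comm]
            exact card_inter_le_one hQ (hLi T (Multiset.mem_cons_of_mem hT)))
          simp only [Multiset.card_cons] at hLc
          omega
        · omega)
    refine ⟨S ::ₘ L₂, by simp [hL₂c]; omega, ?_, ?_⟩
    · intro T hT
      rcases Multiset.mem_cons.1 hT with rfl | hT
      · exact hLi _ (Multiset.mem_cons_self _ _)
      · exact hL₂i T hT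
    · intro u
      rw [Multiset.countP_cons, hL₂]
      by_cases hu : u ∈ S
      · have := hSw u hu
        simp only [hu, if_true]; omega
      · simp [hu]

/-- In a perfect graph some clique meets all stable sets of maximal weight. -/
theorem PerfectOn.exists_clique_meeting {G : SimpleGraph V} {U : Finset V} (hG : PerfectOn G U)
    (a : V → ℕ) (m : ℕ) (hU : ∀ v, a v ≠ 0 → v ∈ U) (hm : 0 < m)
    (ha : ∀ S : Finset V, G.IsIndepSet (S : Set V) → ∑ v ∈ S, a v ≤ m) :
    ∃ Q : Finset V, G.IsClique (Q : Set V) ∧ (∀ v ∈ Q, a v ≠ 0) ∧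
      ∀ S : Finset V, G.IsIndepSet (S : Set V) → ∑ v ∈ S, a v = m → (Q ∩ S).Nonempty := by
  classical
  -- Otherwise each clique `Q` in the support of `a` misses a stable set `T Q` of weight `m`. The
  -- sets `T Q` are counted with multiplicity and then covered again by one stable set fewer.
  by_contra! hcon
  have hex : ∀ Q : Finset V, ∃ S : Finset V, G.IsClique (Q : Set V) → (∀ v ∈ Q, a v ≠ 0) →
      G.IsIndepSet (S : Set V) ∧ ∑ v ∈ S, a v = m ∧ Q ∩ S = ∅ ∧ ∀ v ∈ S, a v ≠ 0 := by
    intro Q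
    by_cases hQ : G.IsClique (Q : Set V) ∧ ∀ v ∈ Q, a v ≠ 0
    · obtain ⟨S, h1, h2, h3⟩ := hcon Q hQ.1 hQ.2
      refine ⟨S.filter fun v => a v ≠ 0, fun _ _ =>
        ⟨h1.mono (Finset.coe_subset.2 (Finset.filter_subset _ _)), ?_, ?_, ?_⟩⟩
      · rw [Finset.sum_filter_ne_zero, h2]
      · refine Finset.subset_empty.1 (h3 ▸ ?_)
        exact Finset.inter_subset_inter_left (Finset.filter_subset _ _)
      · simp
    · exact ⟨∅, fun h h' => absurd ⟨h, h'⟩ hQ⟩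
  choose T hT using hex
  set 𝒬 : Finset (Finset V) :=
    univ.filter fun Q => G.IsClique (Q : Set V) ∧ ∀ v ∈ Q, a v ≠ 0 with h𝒬
  have hmem : ∀ Q ∈ 𝒬, G.IsClique (Q : Set V) ∧ ∀ v ∈ Q, a v ≠ 0 := by simp [h𝒬]
  have hpos : 0 < #𝒬 := Finset.card_pos.2 ⟨∅, by simp [h𝒬]⟩
  set L₀ := 𝒬.val.map T with hL₀
  have hsupp : ∀ v, L₀.countP (v ∈ ·) ≠ 0 → a v ≠ 0 := by
    intro v hv
    obtain ⟨S, hS, hvS⟩ := Multiset.countP_pos.1 (Nat.pos_of_ne_zero hv)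
    obtain ⟨Q, hQ, rfl⟩ := Multiset.mem_map.1 hS
    obtain ⟨h1, h2⟩ := hmem Q hQ
    exact (hT Q h1 h2).2.2.2 v hvS
  obtain ⟨L, hLc, hLi, hL⟩ := hG.exists_indepSet_cover _ (fun v => L₀.countP (v ∈ ·)) (#𝒬 - 1) rfl
    (fun v hv => hU v (hsupp v hv))
    (fun Q hQ => by
      -- Cut down to the support of `a`, the clique belongs to `𝒬`. It meets each `T P` at most once
      -- and its own `T Q'` not at all, whence the bound `#𝒬 - 1`.
      have hQ' : ∑ v ∈ Q, L₀.countP (v ∈ ·) =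
          ∑ v ∈ Q.filter (fun v => a v ≠ 0), L₀.countP (v ∈ ·) := by
        rw [Finset.sum_filter_of_ne]
        exact fun v _ hv => hsupp v hv
      set Q' := Q.filter (fun v => a v ≠ 0) with hQ'def
      have hcl : G.IsClique (Q' : Set V) := hQ.subset (Finset.coe_subset.2 (Finset.filter_subset _ _))
      have hmemQ' : Q' ∈ 𝒬 := by
        rw [h𝒬, Finset.mem_filter]
        exact ⟨mem_univ _, hcl, by simp [hQ'def]⟩
      rw [hQ', sum_countP_eq_sum_card_inter, hL₀, Multiset.map_map]
      change ∑ P ∈ 𝒬, #(T P ∩ Q') ≤ #𝒬 - 1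
      rw [← Finset.sum_erase_add _ _ hmemQ', Finset.inter_comm (T Q'),
        (hT Q' hcl (hmem _ hmemQ').2).2.2.1, Finset.card_empty, add_zero,
        ← Finset.card_erase_of_mem hmemQ', Finset.card_eq_sum_ones]
      refine Finset.sum_le_sum fun P hP => ?_
      obtain ⟨h1, h2⟩ := hmem P (Finset.mem_of_mem_erase hP)
      rw [Finset.inter_comm]
      exact card_inter_le_one hcl (hT P h1 h2).1)
  -- The total `a`-weight is `#𝒬 * m` computed from `L₀`, but at most `(#𝒬 - 1) * m` computed from
  -- `L`.
  have h1 := sum_countP_mul L a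
  have h2 := sum_countP_mul L₀ a
  simp only [hL] at h1
  have h3 := sum_map_le_card_mul L (fun S => ∑ v ∈ S, a v) m (fun S hS => ha S (hLi S hS))
  have h4 : (L₀.map fun S => ∑ v ∈ S, a v).sum = #𝒬 * m := by
    rw [hL₀, Multiset.map_map]
    change ∑ P ∈ 𝒬, ∑ v ∈ T P, a v = _
    rw [Finset.sum_congr rfl (fun P hP => (hT P (hmem P hP).1 (hmem P hP).2).2.1)]
    simp
  rw [← h1, h2, h4, hLc] at h3
  have := Nat.le_of_mul_le_mul_right h3 hm
  omega

/-- Weighted clique covers of perfect graphs: if every stable set has weight at most `m`, then `m`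
cliques cover each vertex exactly as often as its weight says. -/
theorem PerfectOn.exists_clique_cover {G : SimpleGraph V} {U : Finset V} (hG : PerfectOn G U)
    (m : ℕ) : ∀ (a : V → ℕ), (∀ v, a v ≠ 0 → v ∈ U) →
      (∀ S : Finset V, G.IsIndepSet (S : Set V) → ∑ v ∈ S, a v ≤ m) →
      ∃ L : Multiset (Finset V), Multiset.card L = m ∧ (∀ Q ∈ L, G.IsClique (Q : Set V)) ∧
        ∀ v, L.countP (v ∈ ·) = a v := by
  induction m with
  | zero =>
    intro a _ ha
    refine ⟨0, by simp, by simp, fun v => ?_⟩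
    have := ha {v} (by simp)
    simp only [sum_singleton, nonpos_iff_eq_zero] at this
    simp [this]
  | succ m ih =>
    intro a hU ha
    obtain ⟨Q, hQ, hQa, hmeet⟩ := hG.exists_clique_meeting a (m + 1) hU m.succ_pos ha
    -- Removing `Q` lowers every stable set of weight `m + 1`; all others weigh at most `m` already.
    obtain ⟨L, hLc, hLq, hL⟩ := ih (fun v => a v - if v ∈ Q then 1 else 0)
      (fun v hv => hU v (fun h => hv (by simp [h])))
      (fun S hS => by
        have hle := Finset.sum_le_sum (s := S) (f := fun v => a v - if v ∈ Q then 1 else 0)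
          (g := a) (fun v _ => Nat.sub_le _ _)
        rcases (ha S hS).lt_or_eq with h | h
        · omega
        · obtain ⟨v, hv⟩ := hmeet S hS h
          rw [Finset.mem_inter] at hv
          have := Finset.sum_lt_sum (s := S) (f := fun v => a v - if v ∈ Q then 1 else 0)
            (g := a) (fun v _ => Nat.sub_le _ _) ⟨v, hv.2, by
              have := hQa v hv.1
              simp only [hv.1, if_true]; omega⟩
          omega)
    refine ⟨Q ::ₘ L, by simp [hLc], ?_, ?_⟩
    · intro P hP
      rcases Multiset.mem_cons.1 hP with rfl | hP
      · exact hQ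
      · exact hLq P hP
    · intro v
      rw [Multiset.countP_cons, hL]
      by_cases hv : v ∈ Q
      · have := hQa v hv
        simp only [hv, if_true]; omega
      · simp [hv]

/-- The weak perfect graph theorem. -/
theorem PerfectOn.compl {G : SimpleGraph V} {U : Finset V} (hG : PerfectOn G U) :
    PerfectOn Gᶜ U := by
  intro W hW m hm
  -- Cliques of `Gᶜ` are stable sets of `G`, so `m` bounds the stable sets in the indicator weight
  -- of `W`, and the covering cliques of `G` serve as colour classes of `Gᶜ`.
  obtain ⟨L, hLc, hLq, hL⟩ := hG.exists_clique_cover m (fun v => if v ∈ W then 1 else 0)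
    (fun v hv => hW (by simpa using hv))
    (fun S hS => by
      have := hm (S ∩ W) Finset.inter_subset_right
        (by rw [SimpleGraph.isClique_compl]; exact hS.mono (by simp))
      simpa using this)
  rw [← hLc]
  refine colorableOn_compl_of_clique_cover L hLq fun v hv => ?_
  have := hL v
  rw [if_pos (by simpa using hv)] at this
  exact Multiset.countP_pos.1 (by omega)

end Graph

end SymbolicPowers

namespace SymbolicPowers

open Finset

/-! ### Splitting of cover weights and its equivalence with perfection. -/

section Exponents

variable {V : Type*}

theorem ColorableOn.mono {G : SimpleGraph V} {W : Set V} {m n : ℕ} (h : ColorableOn G W m)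
    (hmn : m ≤ n) : ColorableOn G W n := by
  obtain ⟨c, hc, hadj⟩ := h
  exact ⟨c, fun v hv => (hc v hv).trans_le hmn, hadj⟩

theorem exists_injOn_lt_card (T : Finset V) :
    ∃ f : V → ℕ, (∀ x ∈ T, f x < #T) ∧ Set.InjOn f T := by
  classical
  refine ⟨fun x => if h : x ∈ T then T.equivFin ⟨x, h⟩ else 0, fun x hx => ?_, ?_⟩
  · simp [hx]
  · intro x hx y hy hxy
    rw [Finset.mem_coe] at hx hy
    simpa [hx, hy, Fin.val_inj] using hxy

/-- If removing a stable set `S` from `U` leaves `k` vertices and `U` is not `k`-colourable, then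
clique number and chromatic number agree on `U`. -/
theorem exists_clique_colorableOn_of_not_colorableOn [DecidableEq V] {G : SimpleGraph V}
    {U S : Finset V} (hSU : S ⊆ U) (hS : G.IsIndepSet (S : Set V))
    (hU : ¬ ColorableOn G (U : Set V) #(U \ S)) :
    ∃ Q ⊆ U, G.IsClique (Q : Set V) ∧ ColorableOn G (U : Set V) #Q := by
  set K := U \ S with hK
  have hmemK : ∀ x ∈ U, x ∉ S → x ∈ K := fun x hx hxS => by simp [hK, hx, hxS]
  -- Non-adjacent `u`, `v` in `K` could share a colour. Then `K` needs only `#K - 1` colours and `S`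
  -- can take the remaining colour `#K - 1`.
  have hclique : G.IsClique (K : Set V) := by
    intro u hu v hv huv
    by_contra hnadj
    rw [Finset.mem_coe] at hu hv
    apply hU
    obtain ⟨f, hf, hinj⟩ := exists_injOn_lt_card (K.erase v)
    rw [Finset.card_erase_of_mem hv] at hf
    have hpos : 0 < #K := Finset.card_pos.2 ⟨v, hv⟩
    have huK : u ∈ K.erase v := Finset.mem_erase.2 ⟨huv, hu⟩
    refine ⟨fun x => if x ∈ S then #K - 1 else if x = v then f u else f x, ?_, ?_⟩
    · intro x hx
      dsimp only
      split_ifs with h1 h2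
      · omega
      · have := hf u huK; omega
      · have := hf x (Finset.mem_erase.2 ⟨h2, hmemK x hx h1⟩); omega
    · intro x hx y hy hxy heq
      have hne := hxy.ne
      dsimp only at heq
      have hfx : ∀ z ∈ U, z ∉ S → z ≠ v → z ∈ K.erase v ∧ f z < #K - 1 := fun z h1 h2 h3 =>
        have := Finset.mem_erase.2 ⟨h3, hmemK z h1 h2⟩
        ⟨this, hf z this⟩
      have hfu := hf u huK
      split_ifs at heq with h1 h2 h3 h4 h5 h6 h7 h8
      · exact hS h1 h2 hne hxy
      · omega
      · have := (hfx y hy h2 h3).2; omega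
      · omega
      · exact hne (h4.trans h6.symm)
      · have := hinj huK (hfx y hy h5 h6).1 heq
        subst this; subst h4
        exact hnadj hxy.symm
      · have := (hfx x hx h1 h4).2; omega
      · have := hinj (hfx x hx h1 h4).1 huK heq
        subst this; subst h8
        exact hnadj hxy
      · exact hne (hinj (hfx x hx h1 h4).1 (hfx y hy h7 h8).1 heq)
  obtain ⟨f, hf, hinj⟩ := exists_injOn_lt_card K
  -- If every `x ∈ S` had a non-neighbour `g x` in `K`, giving `x` the colour of `g x` would colour
  -- `U` with `#K` colours.
  obtain ⟨x, hxS, hx⟩ : ∃ x ∈ S, ∀ y ∈ K, G.Adj x y := by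
    by_contra! hcon
    choose! g hgK hg using hcon
    apply hU
    refine ⟨fun x => if x ∈ S then f (g x) else f x, ?_, ?_⟩
    · intro x hx
      dsimp only
      split_ifs with h1
      · exact hf _ (hgK x h1)
      · exact hf _ (hmemK x hx h1)
    · intro x hx y hy hxy heq
      dsimp only at heq
      split_ifs at heq with h1 h2 h3
      · exact hS h1 h2 hxy.ne hxy
      · have := hinj (hgK x h1) (hmemK y hy h2) heq
        exact hg x h1 (this ▸ hxy)
      · have := hinj (hmemK x hx h1) (hgK y h3) heq
        exact hg y h3 (this ▸ hxy.symm)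
      · exact hxy.ne (hinj (hmemK x hx h1) (hmemK y hy h3) heq)
  have hxK : x ∉ K := by simp [hK, hxS]
  refine ⟨insert x K, ?_, ?_, ?_⟩
  · exact Finset.insert_subset (hSU hxS) Finset.sdiff_subset
  · rw [Finset.coe_insert, SimpleGraph.isClique_insert]
    exact ⟨hclique, fun y hy _ => hx y hy⟩
  · rw [Finset.card_insert_of_notMem hxK]
    refine ⟨fun x => if x ∈ S then #K else f x, ?_, ?_⟩
    · intro x hx
      dsimp only
      split_ifs with h1
      · omega
      · have := hf _ (hmemK x hx h1); omega
    · intro x hx y hy hxy heq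
      dsimp only at heq
      split_ifs at heq with h1 h2 h3
      · exact hS h1 h2 hxy.ne hxy
      · have := hf y (hmemK y hy h2); omega
      · have := hf x (hmemK x hx h1); omega
      · exact hxy.ne (hinj (hmemK x hx h1) (hmemK y hy h3) heq)

variable [Fintype V] [DecidableEq V]

/-- The vertices outside any stable set have total weight at least `s`. -/
def CoverWeight (G : SimpleGraph V) (s : ℕ) (a : V → ℕ) : Prop :=
  ∀ S : Finset V, G.IsIndepSet (S : Set V) → s ≤ ∑ v ∈ Sᶜ, a v

theorem CoverWeight.le_sum {G : SimpleGraph V} {s : ℕ} {a : V → ℕ} (h : CoverWeight G s a) :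
    s ≤ ∑ v, a v := by
  simpa using h ∅ (by simp)

theorem CoverWeight.sum_le {G : SimpleGraph V} {s : ℕ} {a : V → ℕ} (h : CoverWeight G s a)
    {S : Finset V} (hS : G.IsIndepSet (S : Set V)) : ∑ v ∈ S, a v ≤ ∑ v, a v - s := by
  have h1 := h S hS
  have h2 := Finset.sum_add_sum_compl S a
  omega

theorem CoverWeight.add {G : SimpleGraph V} {s t : ℕ} {a b : V → ℕ} (ha : CoverWeight G s a)
    (hb : CoverWeight G t b) : CoverWeight G (s + t) (a + b) := by
  intro S hS
  simp only [Pi.add_apply, Finset.sum_add_distrib]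
  exact Nat.add_le_add (ha S hS) (hb S hS)

theorem CoverWeight.mono {G : SimpleGraph V} {s : ℕ} {a b : V → ℕ} (ha : CoverWeight G s a)
    (hab : a ≤ b) : CoverWeight G s b :=
  fun S hS => (ha S hS).trans (Finset.sum_le_sum fun v _ => hab v)

/-- If the weight outside a stable set `S` were below `s`, fewer than `s` support vertices would lie
there. Giving each its own colour and `S` one more would be an `s`-colouring. -/
theorem coverWeight_of_not_colorableOn {G : SimpleGraph V} {s : ℕ} {a : V → ℕ}
    (h : ¬ ColorableOn G {v | a v ≠ 0} s) : CoverWeight G s a := by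
  intro S hS
  by_contra! hlt
  apply h
  set T := Sᶜ.filter fun v => a v ≠ 0
  have hT : #T < s := by
    refine lt_of_le_of_lt ?_ hlt
    rw [Finset.card_eq_sum_ones]
    refine le_trans (Finset.sum_le_sum fun v hv => ?_)
      (Finset.sum_le_sum_of_subset (Finset.filter_subset _ _))
    exact Nat.one_le_iff_ne_zero.2 (Finset.mem_filter.1 hv).2
  obtain ⟨f, hf, hinj⟩ := exists_injOn_lt_card T
  have hmem : ∀ v, a v ≠ 0 → v ∉ S → v ∈ T := fun v h1 h2 => by simp [T, h1, h2]
  refine ⟨fun x => if x ∈ S then #T else f x, ?_, ?_⟩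
  · intro x hx
    dsimp only
    split_ifs with h1
    · exact hT
    · exact (hf _ (hmem x hx h1)).trans hT
  · intro x hx y hy hxy heq
    dsimp only at heq
    split_ifs at heq with h1 h2 h3
    · exact hS h1 h2 hxy.ne hxy
    · have := hf y (hmem y hy h2); omega
    · have := hf x (hmem x hx h1); omega
    · exact hxy.ne (hinj (hmem x hx h1) (hmem y hy h3) heq)

/-- In a perfect graph a cover weight of level `s` either has a support that is not `s`-colourable
or splits into two cover weights of smaller level. -/
theorem PerfectOn.not_colorableOn_or_split {G : SimpleGraph V} (hG : PerfectOn G univ) {s : ℕ}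
    (hs : 1 ≤ s) {a : V → ℕ} (ha : CoverWeight G s a) :
    ¬ ColorableOn G {v | a v ≠ 0} s ∨
      ∃ i ∈ Finset.Ico 1 s, ∃ b c, CoverWeight G i b ∧ CoverWeight G (s - i) c ∧ a = b + c := by
  obtain ⟨L, hLc, hLq, hL⟩ := hG.exists_clique_cover (∑ v, a v - s) a (fun v _ => mem_univ v)
    (fun S hS => ha.sum_le hS)
  have hle := ha.le_sum
  have htot : ∑ v, a v = (L.map card).sum := by
    simpa [hL] using sum_countP_eq_sum_card_inter L univ
  -- The `|a| - s` cliques have total size `|a|`, which exceeds their number since `s ≥ 1`.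
  obtain ⟨Q, hQL, hQ2⟩ : ∃ Q ∈ L, 2 ≤ #Q := by
    by_contra! hcon
    have := sum_map_le_card_mul L card 1 (fun Q hQ => Nat.le_of_lt_succ (hcon Q hQ))
    omega
  have hQa : ∀ v ∈ Q, a v ≠ 0 := by
    intro v hv h0
    rw [← hL v, Multiset.countP_eq_zero] at h0
    exact h0 Q hQL hv
  by_cases hQs : s + 1 ≤ #Q
  · left
    intro hcol
    have := hcol.card_le (hLq Q hQL) (fun v hv => hQa v hv)
    omega
  · right
    obtain ⟨L', rfl⟩ := Multiset.exists_cons_of_mem hQL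
    -- A stable set meets `Q` at most once, so the indicator of `Q` has level `#Q - 1`. The rest has
    -- total weight `|a| - #Q` and is covered by `|a| - s - 1` cliques, so its level is `s - (#Q -
    -- 1)`.
    refine ⟨#Q - 1, by rw [Finset.mem_Ico]; omega, fun v => if v ∈ Q then 1 else 0,
      fun v => L'.countP (v ∈ ·), ?_, ?_, ?_⟩
    · intro S hS
      have h1 := card_inter_le_one (hLq Q hQL) hS
      have h2 := Finset.card_sdiff_add_card_inter Q S
      have h3 : ∑ v ∈ Sᶜ, (if v ∈ Q then 1 else 0) = #(Q \ S) := by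
        rw [Finset.sum_ite_mem, ← Finset.card_eq_sum_ones, Finset.inter_comm,
          Finset.sdiff_eq_inter_compl]
      change _ ≤ ∑ v ∈ Sᶜ, (if v ∈ Q then 1 else 0)
      omega
    · intro S hS
      have h1 := sum_countP_eq_sum_card_inter L' S
      have h2 := sum_map_le_card_mul L' (fun P => #(P ∩ S)) 1
        (fun P hP => card_inter_le_one (hLq P (Multiset.mem_cons_of_mem hP)) hS)
      have h3 := Finset.sum_add_sum_compl S fun v => L'.countP (v ∈ ·)
      have h4 : ∑ v, L'.countP (v ∈ ·) = (L'.map card).sum := by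
        simpa using sum_countP_eq_sum_card_inter L' univ
      simp only [Multiset.map_cons, Multiset.sum_cons, Multiset.card_cons] at htot hLc
      change _ ≤ ∑ v ∈ Sᶜ, L'.countP (v ∈ ·)
      omega
    · funext v
      rw [← hL v, Multiset.countP_cons, add_comm]
      rfl

/-- If every cover weight of level `s` has a support that is not `s`-colourable or splits, then the
graph is perfect. -/
theorem perfectOn_of_not_colorableOn_or_split {G : SimpleGraph V}
    (hG : ∀ s, 1 ≤ s → ∀ a : V → ℕ, CoverWeight G s a → ¬ ColorableOn G {v | a v ≠ 0} s ∨
      ∃ i ∈ Finset.Ico 1 s, ∃ b c, CoverWeight G i b ∧ CoverWeight G (s - i) c ∧ a = b + c)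
    (U : Finset V) : PerfectOn G U := by
  classical
  induction U using Finset.strongInduction with
  | _ U ih =>
  have hclique : (∃ Q ⊆ U, G.IsClique (Q : Set V) ∧ ColorableOn G (U : Set V) #Q) →
      PerfectOn G U := by
    rintro ⟨Q, hQU, hQ, hcol⟩ W hW m hm
    rcases hW.eq_or_ssubset with rfl | hW'
    · exact hcol.mono (hm Q hQU hQ)
    · exact ih W hW' W subset_rfl m hm
  obtain ⟨S, hSmem, hSmax⟩ := Finset.exists_max_image
    (U.powerset.filter fun S : Finset V => G.IsIndepSet (S : Set V)) card ⟨∅, by simp⟩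
  rw [Finset.mem_filter, Finset.mem_powerset] at hSmem
  obtain ⟨hSU, hS⟩ := hSmem
  by_cases hcol : ColorableOn G (U : Set V) #(U \ S)
  swap
  · exact hclique (exists_clique_colorableOn_of_not_colorableOn hSU hS hcol)
  rcases Nat.eq_zero_or_pos #(U \ S) with h0 | hpos
  · exact hclique ⟨∅, by simp, by simp, by simpa [h0] using hcol⟩
  have hcard := Finset.card_sdiff_add_card_eq_card hSU
  have hsumU : ∀ T : Finset V, ∑ v ∈ T, (if v ∈ U then 1 else 0) = #(T ∩ U) := by
    intro T; simp
  -- The level is `#(U \ S)` because no stable subset of `U` is larger than `S`.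
  have hUw : CoverWeight G #(U \ S) (fun v => if v ∈ U then 1 else 0) := by
    intro T hT
    have h1 := hSmax (T ∩ U) (by
      rw [Finset.mem_filter, Finset.mem_powerset]
      exact ⟨Finset.inter_subset_right, hT.mono (by simp)⟩)
    have h2 := Finset.sum_add_sum_compl T fun v => if v ∈ U then 1 else 0
    have h3 := hsumU T
    have h4 := hsumU univ
    rw [Finset.univ_inter] at h4
    change _ ≤ ∑ v ∈ Tᶜ, (if v ∈ U then 1 else 0)
    omega
  have hsupp : {v | (if v ∈ U then 1 else 0) ≠ 0} = (U : Set V) := by ext; simp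
  rcases hG _ hpos _ hUw with h | ⟨i, hi, b, c, hb, hc, hbc⟩
  · exact absurd (hsupp ▸ hcol) h
  rw [Finset.mem_Ico] at hi
  have hv : ∀ v, b v + c v = if v ∈ U then 1 else 0 := fun v => (congrFun hbc v).symm
  -- A summand of positive level is nonzero, so the support of the other one is a proper subset of
  -- `U`, and the induction hypothesis applies to it.
  have hproper : ∀ (b c : V → ℕ) (j : ℕ), 1 ≤ j → CoverWeight G j c →
      (∀ v, b v + c v = if v ∈ U then 1 else 0) → PerfectOn G (univ.filter fun v => b v ≠ 0) := by
    intro b c j hj hc hv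
    apply ih
    obtain ⟨u, -, hu⟩ : ∃ u ∈ univ, c u ≠ 0 :=
      Finset.exists_ne_zero_of_sum_ne_zero (by have := hc.le_sum; omega)
    rw [Finset.ssubset_iff_of_subset]
    · refine ⟨u, ?_, ?_⟩
      · by_contra h
        have := hv u
        rw [if_neg h] at this
        omega
      · have := hv u
        simp only [mem_filter, mem_univ, true_and, not_not]
        split_ifs at this <;> omega
    · intro v h
      simp only [mem_filter, mem_univ, true_and] at h
      by_contra h'
      have := hv v
      rw [if_neg h'] at this
      omega
  obtain ⟨L, hLc, hLq, hL⟩ := (hproper b c _ (by omega) hc hv).exists_clique_cover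
    (∑ v, b v - i) b (by simp) (fun T hT => hb.sum_le hT)
  obtain ⟨L', hLc', hLq', hL'⟩ := (hproper c b _ hi.1 hb
    (fun v => (add_comm _ _).trans (hv v))).exists_clique_cover
    (∑ v, c v - (#(U \ S) - i)) c (by simp) (fun T hT => hc.sum_le hT)
  have hcover : ColorableOn Gᶜ (U : Set V) (Multiset.card (L + L')) := by
    refine colorableOn_compl_of_clique_cover _ (fun Q hQ => ?_) fun v hvU => ?_
    · rcases Multiset.mem_add.1 hQ with h | h
      exacts [hLq Q h, hLq' Q h]
    · have h1 := hv v
      rw [if_pos (by simpa using hvU)] at h1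
      apply Multiset.countP_pos.1
      rw [Multiset.countP_add, hL, hL']
      omega
  have hsum : ∑ v, b v + ∑ v, c v = #U := by
    rw [← Finset.sum_add_distrib, Finset.sum_congr rfl fun v _ => hv v, hsumU, Finset.univ_inter]
  -- The two covers use `(|b| - i) + (|c| - (#(U \ S) - i)) = #U - #(U \ S) = #S` cliques.
  have hle : Multiset.card (L + L') ≤ #S := by
    have := hb.le_sum
    have := hc.le_sum
    rw [Multiset.card_add]
    omega
  have hcompl : PerfectOn Gᶜ U := by
    intro W hW m hm
    rcases hW.eq_or_ssubset with rfl | hW'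
    · exact hcover.mono (hle.trans (hm S hSU ((SimpleGraph.isClique_compl G).2 hS)))
    · exact (ih W hW').compl W subset_rfl m hm
  simpa using hcompl.compl

end Exponents

/-! ### Perfection in terms of clique and chromatic numbers. -/

section Perfect

variable {V : Type*}

theorem colorable_induce_iff {G : SimpleGraph V} {W : Set V} {m : ℕ} :
    (G.induce W).Colorable m ↔ ColorableOn G W m := by
  classical
  constructor
  · rintro ⟨c⟩
    refine ⟨fun v => if h : v ∈ W then c ⟨v, h⟩ else 0, fun v hv => by simp [hv], ?_⟩
    intro u hu v hv huv heq
    simp only [hu, hv, dite_true, Fin.val_inj] at heq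
    exact c.valid (v := ⟨u, hu⟩) (w := ⟨v, hv⟩) (by simpa using huv) heq
  · rintro ⟨c, hc, hadj⟩
    exact ⟨SimpleGraph.Coloring.mk (fun v => (⟨c v, hc v v.2⟩ : Fin m)) fun {u v} huv heq =>
      hadj u u.2 v v.2 huv (by simpa using heq)⟩

theorem card_le_cliqueNum_induce [Finite V] {G : SimpleGraph V} {W : Set V} {Q : Finset V}
    (hQ : G.IsClique (Q : Set V)) (hQW : (Q : Set V) ⊆ W) : #Q ≤ (G.induce W).cliqueNum := by
  classical
  have hcl : (G.induce W).IsClique ((Q.subtype (· ∈ W) : Finset W) : Set W) := by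
    intro u hu v hv huv
    simp only [mem_coe, mem_subtype] at hu hv
    exact hQ hu hv (fun h => huv (Subtype.ext h))
  have := hcl.card_le_cliqueNum
  rwa [Finset.card_subtype, Finset.filter_true_of_mem fun v hv => hQW hv] at this

theorem exists_clique_card_eq_cliqueNum_induce (G : SimpleGraph V) (W : Set V) :
    ∃ Q : Finset V, G.IsClique (Q : Set V) ∧ (Q : Set V) ⊆ W ∧ #Q = (G.induce W).cliqueNum := by
  obtain ⟨Q, hQ, hcard⟩ := (G.induce W).exists_isNClique_cliqueNum
  refine ⟨Q.map (Function.Embedding.subtype _), ?_, ?_, by simpa using hcard⟩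
  · intro u hu v hv huv
    simp only [coe_map, Function.Embedding.subtype_apply, Set.mem_image, mem_coe] at hu hv
    obtain ⟨u, hu, rfl⟩ := hu
    obtain ⟨v, hv, rfl⟩ := hv
    exact hQ hu hv (fun h => huv (by rw [h]))
  · intro v hv
    simp only [coe_map, Function.Embedding.subtype_apply, Set.mem_image, mem_coe] at hv
    obtain ⟨v, -, rfl⟩ := hv
    exact v.2

theorem isPerfect_iff_perfectOn [Fintype V] {G : SimpleGraph V} : IsPerfect G ↔ PerfectOn G univ := by
  classical
  constructor
  · intro h W _ m hm
    obtain ⟨Q, hQ, hQW, hcard⟩ := exists_clique_card_eq_cliqueNum_induce G (W : Set V)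
    rw [← colorable_induce_iff, ← SimpleGraph.chromaticNumber_le_iff_colorable, ← h W, ← hcard]
    exact_mod_cast hm Q (by exact_mod_cast hQW) hQ
  · intro h W
    refine le_antisymm ?_ ?_
    · obtain ⟨Q, hQ, hQW, hcard⟩ := exists_clique_card_eq_cliqueNum_induce G W
      refine SimpleGraph.le_chromaticNumber_iff_colorable.2 fun m hm => ?_
      rw [← hcard]
      exact (colorable_induce_iff.1 hm).card_le hQ hQW
    · rw [SimpleGraph.chromaticNumber_le_iff_colorable, colorable_induce_iff]
      have := h (univ.filter (· ∈ W)) (subset_univ _) (G.induce W).cliqueNum fun Q hQ hcl =>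
        card_le_cliqueNum_induce hcl fun v hv => by simpa using hQ hv
      simpa using this

end Perfect

end SymbolicPowers

noncomputable section

namespace SymbolicPowers

open Finset MvPolynomial

/-! ### Joins of squarefree monomial ideals. -/

section MonomialIdeals

variable {V K : Type*} [Field K]

theorem mem_of_forall_monomial_mem {I : Ideal (MvPolynomial V K)} {f : MvPolynomial V K}
    (h : ∀ a ∈ f.support, monomial a (1 : K) ∈ I) : f ∈ I := by
  rw [f.as_sum]
  refine Ideal.sum_mem _ fun a ha => ?_
  have : monomial a (coeff a f) = C (coeff a f) * monomial a 1 := by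
    rw [C_mul_monomial, mul_one]
  rw [this]
  exact I.mul_mem_left _ (h a ha)

theorem mem_restrictSupportIdeal {D : Set (V →₀ ℕ)} {hD : IsUpperSet D} {f : MvPolynomial V K} :
    f ∈ restrictSupportIdeal K D hD ↔ ∀ a ∈ f.support, a ∈ D :=
  Iff.rfl

theorem monomial_mem_restrictSupportIdeal {D : Set (V →₀ ℕ)} {hD : IsUpperSet D} {a : V →₀ ℕ} :
    monomial a (1 : K) ∈ restrictSupportIdeal K D hD ↔ a ∈ D := by
  classical
  rw [mem_restrictSupportIdeal]
  simp [support_monomial]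

/-- The exponents whose support is not contained in a member of `𝒜`. -/
def nonFaces (𝒜 : Set (Set V)) : Set (V →₀ ℕ) :=
  {a | ∀ A ∈ 𝒜, ¬ {v | a v ≠ 0} ⊆ A}

theorem isUpperSet_nonFaces (𝒜 : Set (Set V)) : IsUpperSet (nonFaces 𝒜) := by
  intro a b hab ha A hA hb
  refine ha A hA fun v hv => hb ?_
  have := hab v
  simp only [Set.mem_ofPred_eq] at hv ⊢
  omega

/-- The join is an elimination ideal. A homomorphism killing the generators in `x, y, z` bounds it
from above without carrying out the elimination. -/
theorem join_le_of_ringHom {S : Type*} [CommRing S] {I J : Ideal (MvPolynomial V K)}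
    (ψ : MvPolynomial (V ⊕ V ⊕ V) K →+* S)
    (hI : ∀ p ∈ I, ψ (rename (fun i => Sum.inr (Sum.inl i)) p) = 0)
    (hJ : ∀ p ∈ J, ψ (rename (fun i => Sum.inr (Sum.inr i)) p) = 0)
    (hX : ∀ i, ψ (X (Sum.inl i)) = ψ (X (Sum.inr (Sum.inl i))) + ψ (X (Sum.inr (Sum.inr i))))
    {f : MvPolynomial V K} (hf : f ∈ join I J) : ψ (rename Sum.inl f) = 0 := by
  have hle : I.map (rename (R := K) (fun i : V => (Sum.inr (Sum.inl i) : V ⊕ V ⊕ V)))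
      + J.map (rename (R := K) (fun i : V => (Sum.inr (Sum.inr i) : V ⊕ V ⊕ V)))
      + Ideal.span (Set.range fun i : V => (X (Sum.inl i) - X (Sum.inr (Sum.inl i))
          - X (Sum.inr (Sum.inr i)) : MvPolynomial (V ⊕ V ⊕ V) K)) ≤ RingHom.ker ψ := by
    refine sup_le (sup_le ?_ ?_) ?_
    · rw [Ideal.map_le_iff_le_comap]
      exact fun p hp => hI p hp
    · rw [Ideal.map_le_iff_le_comap]
      exact fun p hp => hJ p hp
    · rw [Ideal.span_le]
      rintro _ ⟨i, rfl⟩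
      simp [hX i]
  exact hle hf

open Classical in
/-- The variable `X i` if `i` belongs to `A`, and zero otherwise. -/
def maskedX (K : Type*) [Field K] (A : Set V) (i : V) : MvPolynomial V K :=
  if i ∈ A then X i else 0

/-- Setting the variables outside `A` to zero. -/
def restrictVars (A : Set V) : MvPolynomial V K →ₐ[K] MvPolynomial V K :=
  aeval (maskedX K A)

theorem coeff_restrictVars {A : Set V} {a : V →₀ ℕ} (ha : {v | a v ≠ 0} ⊆ A)
    (f : MvPolynomial V K) : coeff a (restrictVars A f) = coeff a f := by
  classical
  induction f using MvPolynomial.induction_on' with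
  | add p q hp hq => rw [map_add, coeff_add, coeff_add, hp, hq]
  | monomial b r =>
    by_cases hb : ∀ v ∈ b.support, v ∈ A
    · congr 1
      rw [restrictVars, aeval_monomial, monomial_eq, algebraMap_eq]
      congr 1
      exact Finset.prod_congr rfl fun v hv => by simp only [maskedX, if_pos (hb v hv)]
    · push Not at hb
      obtain ⟨v, hv, hvA⟩ := hb
      have h0 : restrictVars A (monomial b r) = 0 := by
        rw [restrictVars, aeval_monomial, Finsupp.prod]
        rw [Finset.prod_eq_zero hv, mul_zero]
        rw [maskedX, if_neg hvA, zero_pow (Finsupp.mem_support_iff.1 hv)]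
      rw [h0, coeff_zero, coeff_monomial, if_neg]
      rintro rfl
      exact hvA (ha (Finsupp.mem_support_iff.1 hv))

theorem restrictVars_eq_zero {𝒜 : Set (Set V)} {A B : Set V} (hA : A ∈ 𝒜) (hBA : B ⊆ A)
    {f : MvPolynomial V K} (hf : f ∈ restrictSupportIdeal K _ (isUpperSet_nonFaces 𝒜)) :
    restrictVars B f = 0 := by
  classical
  rw [restrictVars, aeval_def, eval₂_eq]
  refine Finset.sum_eq_zero fun a ha => ?_
  have : ¬ {v | a v ≠ 0} ⊆ B := fun h => hf ha A hA (h.trans hBA)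
  rw [Set.not_subset] at this
  obtain ⟨v, hv, hvB⟩ := this
  rw [Finset.prod_eq_zero (Finsupp.mem_support_iff.2 hv), mul_zero]
  rw [maskedX, if_neg hvB, zero_pow hv]

/-- The join of two squarefree monomial ideals, given by the coordinate subspaces on which they
vanish. -/
theorem join_restrictSupportIdeal (𝒜 ℬ : Set (Set V)) :
    join (restrictSupportIdeal K _ (isUpperSet_nonFaces 𝒜))
        (restrictSupportIdeal K _ (isUpperSet_nonFaces ℬ)) =
      restrictSupportIdeal K _ (isUpperSet_nonFaces (Set.image2 (· ∪ ·) 𝒜 ℬ)) := by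
  classical
  refine le_antisymm (fun f hf => ?_) (fun f hf => ?_)
  · rw [mem_restrictSupportIdeal]
    rintro a ha _ ⟨A, hA, B, hB, rfl⟩ hsub
    -- Using `B \ A` rather than `B` for the `z`-variables keeps `x_i = y_i + z_i` true on `A ∩ B`.
    let ψ : MvPolynomial (V ⊕ V ⊕ V) K →ₐ[K] MvPolynomial V K := aeval
      (Sum.elim (maskedX K (A ∪ B)) (Sum.elim (maskedX K A) (maskedX K (B \ A))))
    have hrename : ∀ (g : V → V ⊕ V ⊕ V) (p : MvPolynomial V K), ψ.toRingHom (rename g p) =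
        aeval (Sum.elim (maskedX K (A ∪ B)) (Sum.elim (maskedX K A) (maskedX K (B \ A))) ∘ g) p :=
      fun g p => aeval_rename ..
    have hψ : restrictVars (A ∪ B) f = 0 := by
      have := join_le_of_ringHom ψ.toRingHom ?_ ?_ ?_ hf
      · rwa [hrename] at this
      · intro p hp
        rw [hrename]
        exact restrictVars_eq_zero hA subset_rfl hp
      · intro p hp
        rw [hrename]
        exact restrictVars_eq_zero hB (Set.sdiff_subset (s := B) (t := A)) hp
      · intro i
        by_cases h1 : i ∈ A <;> by_cases h2 : i ∈ B <;> simp [ψ, maskedX, h1, h2]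
    have := coeff_restrictVars (K := K) hsub f
    rw [hψ, coeff_zero] at this
    exact (mem_support_iff.1 ha) this.symm
  · refine mem_of_forall_monomial_mem fun a ha => ?_
    have ha' := hf ha
    rw [join, Ideal.mem_comap]
    set N : Ideal (MvPolynomial (V ⊕ V ⊕ V) K) := _ + _ + Ideal.span _
    -- Modulo `N` each factor `x_i` becomes `y_i + z_i`, which moves `i` from `m` into `b` or into
    -- `c`. Once `m` is empty, the hypothesis forces `b` to be a non-face of `𝒜` or `c` a non-face
    -- of `ℬ`.
    have key : ∀ (m : Multiset V) (b c : V →₀ ℕ),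
        (∀ A ∈ 𝒜, ∀ B ∈ ℬ, {v | b v ≠ 0} ⊆ A → {v | c v ≠ 0} ⊆ B → ¬ ∀ v ∈ m, v ∈ A ∪ B) →
        (m.map fun i => (X (Sum.inl i) : MvPolynomial (V ⊕ V ⊕ V) K)).prod *
          (rename (fun i => Sum.inr (Sum.inl i)) (monomial b (1 : K)) *
            rename (fun i => Sum.inr (Sum.inr i)) (monomial c (1 : K))) ∈ N := by
      intro m
      induction m using Multiset.induction_on with
      | empty =>
        intro b c h
        refine N.mul_mem_left _ ?_
        by_cases hb : b ∈ nonFaces 𝒜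
        · refine N.mul_mem_right _ (Submodule.mem_sup_left (Submodule.mem_sup_left ?_))
          exact Ideal.mem_map_of_mem _ (monomial_mem_restrictSupportIdeal.2 hb)
        · refine N.mul_mem_left _ (Submodule.mem_sup_left (Submodule.mem_sup_right ?_))
          refine Ideal.mem_map_of_mem _ (monomial_mem_restrictSupportIdeal.2 ?_)
          simp only [nonFaces, Set.mem_ofPred_eq, not_forall, not_not] at hb
          obtain ⟨A, hA, hbA⟩ := hb
          exact fun B hB hcB => h A hA B hB hbA hcB (by simp)
      | cons i m ih =>
        intro b c h
        have hsupp : ∀ (d : V →₀ ℕ) (D : Set V), {v | (d + Finsupp.single i 1 : V →₀ ℕ) v ≠ 0} ⊆ D →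
            {v | d v ≠ 0} ⊆ D ∧ i ∈ D := by
          intro d D hd
          refine ⟨fun v hv => hd ?_, hd ?_⟩
          · simp only [Set.mem_ofPred_eq, Finsupp.add_apply] at hv ⊢
            omega
          · simp
        have h1 := ih (b + Finsupp.single i 1) c (fun A hA B hB hb hc hm => by
          obtain ⟨hb, hi⟩ := hsupp b A hb
          refine h A hA B hB hb hc fun v hv => ?_
          rcases Multiset.mem_cons.1 hv with rfl | hv
          exacts [Or.inl hi, hm v hv])
        have h2 := ih b (c + Finsupp.single i 1) (fun A hA B hB hb hc hm => by
          obtain ⟨hc, hi⟩ := hsupp c B hc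
          refine h A hA B hB hb hc fun v hv => ?_
          rcases Multiset.mem_cons.1 hv with rfl | hv
          exacts [Or.inr hi, hm v hv])
        have h3 : (X (Sum.inl i) - X (Sum.inr (Sum.inl i)) - X (Sum.inr (Sum.inr i)) :
            MvPolynomial (V ⊕ V ⊕ V) K) ∈ N :=
          Submodule.mem_sup_right (Ideal.subset_span ⟨i, rfl⟩)
        have hmon : ∀ d : V →₀ ℕ, monomial (d + Finsupp.single i 1) (1 : K) =
            monomial d 1 * X i := by
          intro d
          rw [X, monomial_mul, mul_one]
        rw [hmon, map_mul, rename_X] at h1 h2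
        have h4 := N.add_mem (N.add_mem (N.mul_mem_right
          ((m.map fun i => (X (Sum.inl i) : MvPolynomial (V ⊕ V ⊕ V) K)).prod *
            (rename (fun i => Sum.inr (Sum.inl i)) (monomial b (1 : K)) *
            rename (fun i => Sum.inr (Sum.inr i)) (monomial c (1 : K)))) h3) h1) h2
        convert h4 using 1
        rw [Multiset.map_cons, Multiset.prod_cons]
        ring
    have := key (Finsupp.toMultiset a) 0 0 (fun A hA B hB _ _ hm =>
      ha' _ ⟨A, hA, B, hB, rfl⟩ fun v hv => hm v (by simpa using hv))
    have hmap : rename (Sum.inl : V → V ⊕ V ⊕ V) (monomial a (1 : K)) =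
        ((Finsupp.toMultiset a).map fun i =>
          (X (Sum.inl i) : MvPolynomial (V ⊕ V ⊕ V) K)).prod := by
      rw [Finsupp.toMultiset_map, Finsupp.prod_toMultiset,
        Finsupp.prod_mapDomain_index pow_zero pow_add, monomial_eq, C_1, one_mul,
        Finsupp.prod, map_prod]
      simp only [map_pow, rename_X, Finsupp.prod]
    simpa [hmap] using this

end MonomialIdeals

/-! ### Secant ideals of edge ideals and colourability. -/

section Secant

variable {V K : Type*} [Field K]

/-- The `1`-colourable sets are the stable sets. This form of the edge ideal is the one to which
`join_restrictSupportIdeal` applies. -/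
theorem edgeIdeal_eq_restrictSupportIdeal (G : SimpleGraph V) :
    edgeIdeal K G =
      restrictSupportIdeal K _ (isUpperSet_nonFaces {W : Set V | ColorableOn G W 1}) := by
  classical
  have himage : {p : MvPolynomial V K | ∃ i j, G.Adj i j ∧ p = X i * X j} =
      (fun a => monomial a (1 : K)) ''
        {a | ∃ i j, G.Adj i j ∧ a = Finsupp.single i 1 + Finsupp.single j 1} := by
    ext p
    constructor
    · rintro ⟨i, j, hij, rfl⟩
      exact ⟨_, ⟨i, j, hij, rfl⟩, by simp [X, monomial_mul]⟩
    · rintro ⟨_, ⟨i, j, hij, rfl⟩, rfl⟩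
      exact ⟨i, j, hij, by simp [X, monomial_mul]⟩
  ext f
  rw [edgeIdeal, himage, mem_ideal_span_monomial_image, mem_restrictSupportIdeal]
  refine forall₂_congr fun a _ => ?_
  constructor
  · rintro ⟨_, ⟨i, j, hij, rfl⟩, hle⟩ W ⟨c, hc, hadj⟩ hW
    have hi : i ∈ W := hW (by
      have := hle i
      simp only [Finsupp.add_apply, Finsupp.single_eq_same] at this
      simp only [Set.mem_ofPred_eq]; omega)
    have hj : j ∈ W := hW (by
      have := hle j
      simp only [Finsupp.add_apply, Finsupp.single_eq_same] at this
      simp only [Set.mem_ofPred_eq]; omega)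
    have h1 := hc i hi
    have h2 := hc j hj
    exact hadj i hi j hj hij (by omega)
  · intro h
    have hnot : ¬ ColorableOn G {v | a v ≠ 0} 1 := fun hcol => h _ hcol subset_rfl
    have hex : ∃ i j, a i ≠ 0 ∧ a j ≠ 0 ∧ G.Adj i j := by
      by_contra! hcon
      exact hnot ⟨fun _ => 0, fun _ _ => one_pos, fun u hu v hv huv => absurd huv (hcon u v hu hv)⟩
    obtain ⟨i, j, hi, hj, hij⟩ := hex
    refine ⟨_, ⟨i, j, hij, rfl⟩, fun v => ?_⟩
    have hne := hij.ne
    simp only [Finsupp.add_apply, Finsupp.single_apply]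
    split_ifs with h1 h2 h2
    · exact absurd (h1.trans h2.symm) hne
    · subst h1; omega
    · subst h2; omega
    · omega

/-- Splitting off the last colour class is the combinatorial counterpart of one more join with the
edge ideal. -/
theorem image2_union_colorableOn (G : SimpleGraph V) (r : ℕ) :
    Set.image2 (· ∪ ·) {W : Set V | ColorableOn G W r} {W : Set V | ColorableOn G W 1} =
      {W : Set V | ColorableOn G W (r + 1)} := by
  classical
  ext W
  constructor
  · rintro ⟨A, ⟨c, hc, hadj⟩, B, ⟨d, hd, hadj'⟩, rfl⟩
    refine ⟨fun v => if v ∈ A then c v else r, fun v hv => ?_, fun u hu v hv huv heq => ?_⟩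
    · dsimp only
      split_ifs with h
      · exact (hc v h).trans (Nat.lt_succ_self r)
      · exact Nat.lt_succ_self r
    · dsimp only at heq
      split_ifs at heq with h1 h2 h2
      · exact hadj u h1 v h2 huv heq
      · exact (hc u h1).ne heq
      · exact (hc v h2).ne heq.symm
      · have hu' := hu.resolve_left h1
        have hv' := hv.resolve_left h2
        have h3 := hd u hu'
        have h4 := hd v hv'
        exact hadj' u hu' v hv' huv (by omega)
  · rintro ⟨c, hc, hadj⟩
    refine ⟨{v ∈ W | c v < r}, ⟨c, fun v hv => hv.2, fun u hu v hv => hadj u hu.1 v hv.1⟩,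
      {v ∈ W | c v = r}, ⟨fun _ => 0, fun _ _ => one_pos, fun u hu v hv huv =>
        absurd (hu.2.trans hv.2.symm) (hadj u hu.1 v hv.1 huv)⟩, ?_⟩
    ext v
    constructor
    · rintro (h | h)
      exacts [h.1, h.1]
    · intro h
      rcases (Nat.lt_succ_iff.1 (hc v h)).lt_or_eq with h' | h'
      exacts [Or.inl ⟨h, h'⟩, Or.inr ⟨h, h'⟩]

/-- The secant ideals of an edge ideal are spanned by the monomials whose support is not
`r`-colourable. -/
theorem secantIdeal_edgeIdeal (G : SimpleGraph V) (r : ℕ) :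
    secantIdeal (edgeIdeal K G) (r + 1) =
      restrictSupportIdeal K _ (isUpperSet_nonFaces {W : Set V | ColorableOn G W (r + 1)}) := by
  induction r with
  | zero => exact edgeIdeal_eq_restrictSupportIdeal G
  | succ r ih =>
    change join (secantIdeal (edgeIdeal K G) (r + 1)) (edgeIdeal K G) = _
    rw [ih, edgeIdeal_eq_restrictSupportIdeal, join_restrictSupportIdeal]
    congr 2
    exact image2_union_colorableOn G (r + 1)

theorem mem_nonFaces_colorableOn {G : SimpleGraph V} {r : ℕ} {a : V →₀ ℕ} :
    a ∈ nonFaces {W : Set V | ColorableOn G W r} ↔ ¬ ColorableOn G {v | a v ≠ 0} r := by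
  refine ⟨fun h hc => h _ hc subset_rfl, fun h W hW hsub => h ?_⟩
  obtain ⟨c, hc, hadj⟩ := hW
  exact ⟨c, fun v hv => hc v (hsub hv), fun u hu v hv => hadj u (hsub hu) v (hsub hv)⟩

end Secant

end SymbolicPowers

end

noncomputable section

namespace SymbolicPowers

open Finset MvPolynomial

/-! ### Symbolic powers of edge ideals and vertex covers. -/

section SymbolicPowers

variable {V K : Type*} [Field K]

theorem X_mul_X_mem_edgeIdeal {G : SimpleGraph V} {i j : V} (h : G.Adj i j) :
    (X i * X j : MvPolynomial V K) ∈ edgeIdeal K G :=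
  Ideal.subset_span ⟨i, j, h, rfl⟩

variable [DecidableEq V]

/-- Multiply the variables in `C` by a new variable `t`. -/
def weightHom (K : Type*) [Field K] (C : Finset V) :
    MvPolynomial V K →ₐ[K] Polynomial (MvPolynomial V K) :=
  aeval fun i => if i ∈ C then Polynomial.X * Polynomial.C (X i) else Polynomial.C (X i)

theorem weightHom_monomial [Fintype V] (C : Finset V) (a : V →₀ ℕ) (r : K) :
    weightHom K C (monomial a r) = Polynomial.monomial (∑ i ∈ C, a i) (monomial a r) := by
  have h1 : ∀ i, (if i ∈ C then Polynomial.X * Polynomial.C (X i) else Polynomial.C (X i) :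
      Polynomial (MvPolynomial V K)) ^ a i =
      Polynomial.X ^ (if i ∈ C then a i else 0) * Polynomial.C (X i ^ a i) := by
    intro i
    split_ifs
    · rw [mul_pow, Polynomial.C_pow]
    · rw [pow_zero, one_mul, Polynomial.C_pow]
  rw [weightHom, aeval_monomial, Finsupp.prod_fintype _ _ (by simp)]
  simp only [h1]
  rw [Finset.prod_mul_distrib, Finset.prod_pow_eq_pow_sum, ← map_prod, Finset.sum_ite_mem,
    Finset.univ_inter, ← Polynomial.C_mul_X_pow_eq_monomial, monomial_eq,
    Finsupp.prod_fintype _ _ (by simp), map_mul]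
  rw [show algebraMap K (Polynomial (MvPolynomial V K)) r =
    Polynomial.C (MvPolynomial.C r) from rfl]
  ring

theorem coeff_coeff_weightHom [Fintype V] (C : Finset V) (f : MvPolynomial V K) (k : ℕ)
    (a : V →₀ ℕ) :
    coeff a ((weightHom K C f).coeff k) = if ∑ i ∈ C, a i = k then coeff a f else 0 := by
  induction f using MvPolynomial.induction_on' with
  | add p q hp hq =>
    rw [map_add, Polynomial.coeff_add, coeff_add, hp, hq, coeff_add]
    split_ifs <;> simp
  | monomial b r =>
    rw [weightHom_monomial, Polynomial.coeff_monomial]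
    by_cases hab : b = a
    · subst hab
      split_ifs <;> simp
    · split_ifs <;> simp [coeff_monomial, hab]

/-- The order of `weightHom K C f` in the new variable is the least weight on `C` of a monomial of
`f`. As that variable is prime, this order behaves like a valuation, and denominators outside
`varsIdeal K C` can be cancelled. -/
theorem X_pow_dvd_weightHom_iff [Fintype V] {C : Finset V} {f : MvPolynomial V K} {s : ℕ} :
    Polynomial.X ^ s ∣ weightHom K C f ↔ ∀ a ∈ f.support, s ≤ ∑ i ∈ C, a i := by
  rw [Polynomial.X_pow_dvd_iff]
  constructor
  · intro h a ha
    by_contra! hlt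
    have := coeff_coeff_weightHom C f (∑ i ∈ C, a i) a
    rw [h _ hlt, if_pos rfl, coeff_zero] at this
    exact mem_support_iff.1 ha this.symm
  · intro h k hk
    ext a
    rw [coeff_coeff_weightHom, coeff_zero]
    split_ifs with hak
    · by_contra hne
      have := h a (mem_support_iff.2 hne)
      omega
    · rfl

/-- The prime ideal generated by the variables in `C`. -/
def varsIdeal (K : Type*) [Field K] (C : Finset V) : Ideal (MvPolynomial V K) :=
  (Ideal.span {Polynomial.X}).comap (weightHom K C)

theorem mem_varsIdeal {C : Finset V} {f : MvPolynomial V K} :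
    f ∈ varsIdeal K C ↔ Polynomial.X ∣ weightHom K C f := by
  rw [varsIdeal, Ideal.mem_comap, Ideal.mem_span_singleton]

instance varsIdeal_isPrime (C : Finset V) : (varsIdeal K C).IsPrime := by
  have : (Ideal.span {(Polynomial.X : Polynomial (MvPolynomial V K))}).IsPrime :=
    (Ideal.span_singleton_prime Polynomial.X_ne_zero).2 Polynomial.prime_X
  exact Ideal.IsPrime.comap _

variable [Fintype V]

theorem mem_varsIdeal_iff {C : Finset V} {f : MvPolynomial V K} :
    f ∈ varsIdeal K C ↔ ∀ a ∈ f.support, ∃ i ∈ C, a i ≠ 0 := by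
  rw [mem_varsIdeal, ← pow_one Polynomial.X, X_pow_dvd_weightHom_iff]
  refine forall₂_congr fun a _ => ?_
  rw [Nat.one_le_iff_ne_zero, Ne, Finset.sum_eq_zero_iff]
  push Not
  rfl

theorem X_mem_varsIdeal {C : Finset V} {i : V} :
    (X i : MvPolynomial V K) ∈ varsIdeal K C ↔ i ∈ C := by
  rw [mem_varsIdeal_iff]
  simp [support_X, Finsupp.single_apply]

theorem edgeIdeal_le_varsIdeal {G : SimpleGraph V} {C : Finset V}
    (h : ∀ i j, G.Adj i j → i ∈ C ∨ j ∈ C) : edgeIdeal K G ≤ varsIdeal K C := by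
  rw [edgeIdeal, Ideal.span_le]
  rintro _ ⟨i, j, hij, rfl⟩
  rcases h i j hij with h | h
  · exact Ideal.mul_mem_right _ _ (X_mem_varsIdeal.2 h)
  · exact Ideal.mul_mem_left _ _ (X_mem_varsIdeal.2 h)

theorem varsIdeal_le {C : Finset V} {P : Ideal (MvPolynomial V K)}
    (h : ∀ i ∈ C, (X i : MvPolynomial V K) ∈ P) : varsIdeal K C ≤ P := by
  intro f hf
  refine mem_of_forall_monomial_mem fun a ha => ?_
  obtain ⟨i, hi, hai⟩ := mem_varsIdeal_iff.1 hf a ha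
  exact P.mem_of_dvd (X_dvd_monomial.2 (Or.inr hai)) (h i hi)

/-- Every minimal prime of an edge ideal is generated by the variables of a vertex cover `C`, and
each vertex of `C` has a neighbour outside `C`. -/
theorem exists_eq_varsIdeal_of_mem_minimalPrimes {G : SimpleGraph V}
    {P : Ideal (MvPolynomial V K)} (hP : P ∈ (edgeIdeal K G).minimalPrimes) :
    ∃ C : Finset V, P = varsIdeal K C ∧ (∀ i j, G.Adj i j → i ∈ C ∨ j ∈ C) ∧
      ∀ i ∈ C, ∃ j ∉ C, G.Adj i j := by
  classical
  have hprime := hP.1.1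
  set C : Finset V := univ.filter fun i => (X i : MvPolynomial V K) ∈ P with hC
  have hmem : ∀ i, i ∈ C ↔ (X i : MvPolynomial V K) ∈ P := by simp [hC]
  have hcover : ∀ i j, G.Adj i j → i ∈ C ∨ j ∈ C := by
    intro i j hij
    rw [hmem, hmem]
    exact hprime.mem_or_mem (hP.1.2 (X_mul_X_mem_edgeIdeal hij))
  refine ⟨C, ?_, hcover, ?_⟩
  · have hle := varsIdeal_le (C := C) fun i hi => (hmem i).1 hi
    exact le_antisymm (hP.2 ⟨varsIdeal_isPrime C, edgeIdeal_le_varsIdeal hcover⟩ hle) hle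
  -- If all neighbours of `i` lay in `C`, then `C.erase i` would still be a vertex cover and would
  -- give a smaller prime.
  · intro i hi
    by_contra! hcon
    have hnb : ∀ j, G.Adj i j → j ∈ C := fun j hij => by
      by_contra hj
      exact hcon j hj hij
    have hcover' : ∀ u v, G.Adj u v → u ∈ C.erase i ∨ v ∈ C.erase i := by
      intro u v huv
      simp only [Finset.mem_erase]
      by_cases hu : u = i
      · subst hu
        exact Or.inr ⟨huv.ne', hnb v huv⟩
      · by_cases hv : v = i
        · subst hv
          exact Or.inl ⟨hu, hnb u huv.symm⟩
        · exact (hcover u v huv).imp (fun h => ⟨hu, h⟩) (fun h => ⟨hv, h⟩)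
    have hle := varsIdeal_le (C := C.erase i) fun j hj => (hmem j).1 (Finset.mem_of_mem_erase hj)
    have := hP.2 ⟨varsIdeal_isPrime _, edgeIdeal_le_varsIdeal hcover'⟩ hle ((hmem i).1 hi)
    simp [X_mem_varsIdeal] at this

/-- The cover `Sᶜ` contains the cover `C` of a minimal prime. A denominator `u` with `u * f ∈ I ^ s`
has order zero along `C`, so `f` has order at least `s` there. -/
theorem coverWeight_of_mem_symbolicPower {G : SimpleGraph V} {s : ℕ} {f : MvPolynomial V K}
    (hf : f ∈ symbolicPower (edgeIdeal K G) s) {a : V →₀ ℕ} (ha : a ∈ f.support) :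
    CoverWeight G s a := by
  intro S hS
  rw [symbolicPower, Ideal.mem_comap, IsLocalization.algebraMap_mem_map_algebraMap_iff
    (avoidMinimalPrimes (edgeIdeal K G))] at hf
  obtain ⟨u, hu, huf⟩ := hf
  have hcov : ∀ i j, G.Adj i j → i ∈ Sᶜ ∨ j ∈ Sᶜ := by
    intro i j hij
    by_contra! hcon
    simp only [mem_compl, not_not] at hcon
    exact hS hcon.1 hcon.2 hij.ne hij
  obtain ⟨P, hP, hle⟩ := Ideal.exists_minimalPrimes_le (edgeIdeal_le_varsIdeal (K := K) hcov)
  obtain ⟨C, rfl, hC, -⟩ := exists_eq_varsIdeal_of_mem_minimalPrimes hP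
  have hCS : C ⊆ Sᶜ := fun i hi => X_mem_varsIdeal.1 (hle (X_mem_varsIdeal.2 hi))
  have hu' : ¬ Polynomial.X ∣ weightHom K C u := fun h => hu _ hP (mem_varsIdeal.2 h)
  have hdvd : Polynomial.X ^ s ∣ weightHom K C u * weightHom K C f := by
    rw [← map_mul, ← Ideal.mem_span_singleton, ← Ideal.span_singleton_pow]
    have h1 : (edgeIdeal K G).map (weightHom K C) ≤ Ideal.span {Polynomial.X} :=
      Ideal.map_le_iff_le_comap.2 (edgeIdeal_le_varsIdeal hC)
    refine Ideal.pow_right_mono h1 s ?_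
    rw [← Ideal.map_pow]
    exact Ideal.mem_map_of_mem _ huf
  have hdvd' := Polynomial.prime_X.pow_dvd_of_dvd_mul_left s hu' hdvd
  exact (X_pow_dvd_weightHom_iff.1 hdvd' a ha).trans (Finset.sum_le_sum_of_subset hCS)

/-- By prime avoidance, if no admissible denominator exists, the colon ideal of `I ^ s` by the
monomial lies in a single minimal prime. A power of the product of the variables outside its cover
contradicts this. -/
theorem monomial_mem_symbolicPower {G : SimpleGraph V} {s : ℕ} {a : V →₀ ℕ}
    (ha : CoverWeight G s a) : monomial a (1 : K) ∈ symbolicPower (edgeIdeal K G) s := by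
  rw [symbolicPower, Ideal.mem_comap, IsLocalization.algebraMap_mem_map_algebraMap_iff
    (avoidMinimalPrimes (edgeIdeal K G))]
  by_contra! hcon
  have hsub : (((edgeIdeal K G ^ s).colon {monomial a (1 : K)} : Ideal (MvPolynomial V K)) :
      Set (MvPolynomial V K)) ⊆ ⋃ P ∈ (edgeIdeal K G).minimalPrimes, (id P : Ideal _) := by
    intro u hu
    by_contra hnot
    refine hcon u ?_ ?_
    · intro P hP huP
      exact hnot (Set.mem_biUnion hP huP)
    · simpa [Submodule.mem_colon_singleton] using hu
  obtain ⟨P, hP, hle⟩ := (Ideal.subset_union_prime_finite (f := id)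
    (Ideal.finite_minimalPrimes_of_isNoetherianRing _ (edgeIdeal K G)) ⊥ ⊥
    fun P hP _ _ => hP.1.1).1 hsub
  obtain ⟨C, rfl, hC, hnb⟩ := exists_eq_varsIdeal_of_mem_minimalPrimes hP
  set p : MvPolynomial V K := ∏ j ∈ Cᶜ, X j with hp
  have hpC : p ∉ varsIdeal K C := by
    rw [hp, (varsIdeal_isPrime C).prod_mem_iff]
    rintro ⟨j, hj, hjC⟩
    exact (Finset.mem_compl.1 hj) (X_mem_varsIdeal.1 hjC)
  -- Each `i ∈ C` has a neighbour outside `C`, so one factor `p` for each variable from `C` in the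
  -- monomial produces an element of `I`. This explains the exponent `∑ i ∈ C, a i`.
  have hXp : ∀ i ∈ C, X i * p ∈ edgeIdeal K G := by
    intro i hi
    obtain ⟨j, hj, hij⟩ := hnb i hi
    refine Ideal.mem_of_dvd _ ?_ (X_mul_X_mem_edgeIdeal hij)
    exact mul_dvd_mul_left _ (Finset.dvd_prod_of_mem _ (Finset.mem_compl.2 hj))
  have hcov : s ≤ ∑ i ∈ C, a i := by
    have := ha Cᶜ (fun i hi j hj _ hij => by
      simp only [coe_compl, Set.mem_compl_iff, mem_coe] at hi hj
      exact (hC i j hij).elim hi hj)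
    rwa [compl_compl] at this
  refine hpC ((varsIdeal_isPrime C).mem_of_pow_mem (∑ i ∈ C, a i) (hle ?_))
  have hmon : p ^ (∑ i ∈ C, a i) * monomial a (1 : K) =
      (∏ i ∈ C, (X i * p) ^ a i) * ∏ i ∈ Cᶜ, X i ^ a i := by
    have h1 : monomial a (1 : K) = ∏ i, X i ^ a i := by
      rw [monomial_eq, Finsupp.prod_fintype _ _ (by simp)]
      simp
    rw [h1, ← Finset.prod_mul_prod_compl C, ← Finset.prod_pow_eq_pow_sum]
    simp only [mul_pow, Finset.prod_mul_distrib]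
    ring
  rw [Submodule.mem_colon_singleton, smul_eq_mul, hmon]
  refine Ideal.mul_mem_right _ _ (Ideal.pow_le_pow_right hcov ?_)
  rw [← Finset.prod_pow_eq_pow_sum]
  exact Ideal.prod_mem_prod fun i hi => Ideal.pow_mem_pow (hXp i hi) _

/-- The symbolic powers of an edge ideal are spanned by the monomials of sufficient weight on every
vertex cover. -/
theorem mem_symbolicPower_edgeIdeal {G : SimpleGraph V} {s : ℕ} {f : MvPolynomial V K} :
    f ∈ symbolicPower (edgeIdeal K G) s ↔ ∀ a ∈ f.support, CoverWeight G s a :=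
  ⟨fun hf _ ha => coverWeight_of_mem_symbolicPower hf ha,
    fun h => mem_of_forall_monomial_mem fun a ha => monomial_mem_symbolicPower (h a ha)⟩

theorem monomial_mem_symbolicPower_iff {G : SimpleGraph V} {s : ℕ} {a : V →₀ ℕ} :
    monomial a (1 : K) ∈ symbolicPower (edgeIdeal K G) s ↔ CoverWeight G s a := by
  rw [mem_symbolicPower_edgeIdeal]
  simp

/-! ### The defining equation as a condition on exponents. -/

/-- The exponents that are not `s`-colourable or split into two cover weights of smaller level. -/
def decomposableExponents (G : SimpleGraph V) (s : ℕ) : Set (V →₀ ℕ) :=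
  {a | ¬ ColorableOn G {v | a v ≠ 0} s ∨
    ∃ i ∈ Finset.Ico 1 s, ∃ b c : V →₀ ℕ,
      CoverWeight G i b ∧ CoverWeight G (s - i) c ∧ a = b + c}

theorem isUpperSet_decomposableExponents (G : SimpleGraph V) (s : ℕ) :
    IsUpperSet (decomposableExponents G s) := by
  rintro a a' hle (h | ⟨i, hi, b, c, hb, hc, rfl⟩)
  · left
    rw [← mem_nonFaces_colorableOn] at h ⊢
    exact isUpperSet_nonFaces _ hle h
  -- The surplus of `a'` over `b + c` is added to `c`, since levels survive enlarging the weight.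
  · refine Or.inr ⟨i, hi, b, c + (a' - (b + c)), hb, hc.mono ?_, ?_⟩
    · intro v; simp
    · rw [← add_assoc, add_tsub_cancel_of_le hle]

/-- The right-hand side of the equation that defines `1`-differential perfection. -/
theorem secantIdeal_add_sum_symbolicPower (G : SimpleGraph V) {s : ℕ} (hs : 1 ≤ s) :
    secantIdeal (edgeIdeal K G) s + ∑ i ∈ Finset.Ico 1 s,
        symbolicPower (edgeIdeal K G) i * symbolicPower (edgeIdeal K G) (s - i) =
      restrictSupportIdeal K _ (isUpperSet_decomposableExponents G s) := by
  have hsec : secantIdeal (edgeIdeal K G) s =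
      restrictSupportIdeal K _ (isUpperSet_nonFaces {W : Set V | ColorableOn G W s}) := by
    obtain ⟨r, rfl⟩ : ∃ r, s = r + 1 := ⟨s - 1, by omega⟩
    exact secantIdeal_edgeIdeal G r
  rw [hsec, Submodule.add_eq_sup, Ideal.sum_eq_sup, Finset.sup_eq_iSup]
  apply le_antisymm
  · refine sup_le (fun f hf a ha => Or.inl (mem_nonFaces_colorableOn.1 (hf ha)))
      (iSup₂_le fun i hi => Ideal.mul_le.2 fun f hf g hg a ha => ?_)
    obtain ⟨b, hb, c, hc, rfl⟩ := Finset.mem_add.1 (support_mul f g ha)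
    exact Or.inr ⟨i, hi, b, c, coverWeight_of_mem_symbolicPower hf hb,
      coverWeight_of_mem_symbolicPower hg hc, rfl⟩
  · refine fun f hf => mem_of_forall_monomial_mem fun a ha => ?_
    rcases hf ha with h | ⟨i, hi, b, c, hb, hc, rfl⟩
    · exact Submodule.mem_sup_left
        (monomial_mem_restrictSupportIdeal.2 (mem_nonFaces_colorableOn.2 h))
    · refine Submodule.mem_sup_right (le_iSup₂ (f := fun i _ => symbolicPower (edgeIdeal K G) i *
        symbolicPower (edgeIdeal K G) (s - i)) i hi ?_)
      rw [← mul_one (1 : K), ← monomial_mul]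
      exact Ideal.mul_mem_mul (monomial_mem_symbolicPower hb) (monomial_mem_symbolicPower hc)

/-- This gives the inclusion of the right-hand side in the symbolic power, which holds for every
graph; only the converse inclusion depends on perfection. -/
theorem coverWeight_of_mem_decomposableExponents {G : SimpleGraph V} {s : ℕ} {a : V →₀ ℕ}
    (h : a ∈ decomposableExponents G s) : CoverWeight G s a := by
  rcases h with h | ⟨i, hi, b, c, hb, hc, rfl⟩
  · exact coverWeight_of_not_colorableOn h
  · have := hb.add hc
    rw [Finset.mem_Ico] at hi
    rwa [show i + (s - i) = s by omega] at this

theorem isDifferentiallyPerfect_edgeIdeal_iff (G : SimpleGraph V) :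
    IsDifferentiallyPerfect 1 (edgeIdeal K G) ↔
      ∀ s, 1 ≤ s → ∀ a : V →₀ ℕ, CoverWeight G s a → a ∈ decomposableExponents G s := by
  refine forall₂_congr fun s hs => ?_
  rw [Nat.add_sub_cancel_left, show secantIdeal (edgeIdeal K G) 1 = edgeIdeal K G from rfl,
    secantIdeal_add_sum_symbolicPower G hs]
  constructor
  · intro h a ha
    rw [← monomial_mem_symbolicPower_iff (K := K), h] at ha
    exact monomial_mem_restrictSupportIdeal.1 ha
  · intro h
    ext f
    rw [mem_symbolicPower_edgeIdeal, mem_restrictSupportIdeal]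
    exact forall₂_congr fun a _ => ⟨h a, coverWeight_of_mem_decomposableExponents⟩

end SymbolicPowers

end SymbolicPowers

end

theorem mainTheorem1 {K : Type*} [Field K] {V : Type*} [Finite V] (G : SimpleGraph V) :
    SymbolicPowers.IsDifferentiallyPerfect 1 (SymbolicPowers.edgeIdeal K G) ↔
      SymbolicPowers.IsPerfect G := by
  classical
  cases nonempty_fintype V
  rw [SymbolicPowers.isDifferentiallyPerfect_edgeIdeal_iff,
    SymbolicPowers.isPerfect_iff_perfectOn]
  constructor
  · intro h
    refine SymbolicPowers.perfectOn_of_not_colorableOn_or_split (fun s hs a ha => ?_) _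
    rcases h s hs (Finsupp.equivFunOnFinite.symm a) ha with h | ⟨i, hi, b, c, hb, hc, hbc⟩
    · exact Or.inl h
    · exact Or.inr ⟨i, hi, b, c, hb, hc, congrArg DFunLike.coe hbc⟩
  · intro h s hs a ha
    rcases h.not_colorableOn_or_split hs ha with h | ⟨i, hi, b, c, hb, hc, hbc⟩
    · exact Or.inl h
    · exact Or.inr ⟨i, hi, Finsupp.equivFunOnFinite.symm b, Finsupp.equivFunOnFinite.symm c,
        hb, hc, DFunLike.coe_injective hbc⟩
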